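/- For a positive integer $n$ and nontrivial Boolean algebras $A,B$, a function $f\colon X\to B$ on a subset $X\subseteq A$ is $n$-preserving if for all $a_0,\dots,a_{n-1}\in X$, $\prod_{i<n}a_i=0$ implies $\prod_{i<n}f(a_i)=0$. The algebra $A$ is $n$-free over $X$ if every $n$-preserving function from $X$ into an arbitrary nontrivial Boolean algebra $B$ extends to a unique homomorphism $A\to B$, and $A$ is $n$-free if it is $n$-free over some $X\subseteq A$. A set $X\subseteq A$ is $n$-independent if $0\notin X$ and for all nonempty finite $F,G\subseteq X$: (i) $\sum F\neq 1$; (ii) if $\prod F=0$, then there is $F'\subseteq F$ with $|F'|\le n$ and $\prod F'=0$; (iii) if $0\neq\prod F\le\sum G$, then $F\cap G\neq\emptyset$. Let $\mathrm{FinCo}(\omega_1)$ be the Boolean algebra of finite and cofinite subsets of $\omega_1$, and let $\mathrm{Fr}(\omega_1)$ be the free Boolean algebra on $\omega_1$ generators. Theorem. The product $\mathrm{FinCo}(\omega_1)\times\mathrm{Fr}(\omega_1)$ is not $2$-free, and it has no $2$-independent generating set. However, $\mathrm{FinCo}(\omega_1)$ and $\mathrm{Fr}(\omega_1)$ are both $2$-free,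 so a product of two $2$-free Boolean algebras need not be $2$-free. Moreover, $\mathrm{FinCo}(\omega_1)\times\mathrm{Fr}(\omega_1)$ is $3$-free. -/

import Mathlib

open scoped Ordinal

universe u

/-- `f : U → B` is `n`-preserving (`n` a positive integer): whenever `a₀, …, aₙ₋₁ ∈ U`
(repetitions allowed) have meet `0`, so do `f a₀, …, f aₙ₋₁`. -/
def IsNPreserving (n : ℕ) {A B : Type u} [BooleanAlgebra A] [BooleanAlgebra B]
    {U : Set A} (f : U → B) : Prop :=
  ∀ a : Fin n → U, (Finset.univ.inf fun i => (a i : A)) = ⊥ →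
    (Finset.univ.inf fun i => f (a i)) = ⊥

/-- `A` is `n`-free over `X`: every `n`-preserving function from `X` into a nontrivial Boolean
algebra `B` extends to a unique homomorphism of Boolean algebras `A → B`. (Bounded lattice
homomorphisms between Boolean algebras are exactly the Boolean homomorphisms.) -/
def IsNFreeOver (n : ℕ) {A : Type u} [BooleanAlgebra A] (X : Set A) : Prop :=
  ∀ (B : Type u) [BooleanAlgebra B] [Nontrivial B] (f : X → B), IsNPreserving n f →
    ∃! g : BoundedLatticeHom A B, ∀ x : X, g (x : A) = f x

/-- `A` is `n`-free: it is `n`-free over some subset. -/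
def IsNFree (n : ℕ) (A : Type u) [BooleanAlgebra A] : Prop :=
  ∃ X : Set A, IsNFreeOver n X

/-- `X` is `n`-independent (`n` a positive integer). -/
def IsNIndependent (n : ℕ) {A : Type u} [BooleanAlgebra A] (X : Set A) : Prop :=
  ⊥ ∉ X ∧ ∀ F G : Finset A, F.Nonempty → G.Nonempty → (F : Set A) ⊆ X → (G : Set A) ⊆ X →
    F.sup id ≠ ⊤ ∧
    (F.inf id = ⊥ → ∃ F' : Finset A, F' ⊆ F ∧ F'.card ≤ n ∧ F'.inf id = ⊥) ∧
    (F.inf id ≠ ⊥ → F.inf id ≤ G.sup id → ∃ x, x ∈ F ∧ x ∈ G)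

/-- `X` generates `A` as a Boolean algebra. -/
def GeneratesBA {A : Type u} [BooleanAlgebra A] (X : Set A) : Prop :=
  BooleanSubalgebra.closure X = ⊤

/-- The finite-cofinite algebra on `κ`. -/
def FinCo (κ : Type u) : BooleanSubalgebra (Set κ) where
  carrier := {s | s.Finite ∨ sᶜ.Finite}
  supClosed' := by
    rintro s (hs | hs) t (ht | ht)
    · exact Or.inl (hs.union ht)
    · exact Or.inr (ht.subset (Set.compl_subset_compl.2 Set.subset_union_right))
    · exact Or.inr (hs.subset (Set.compl_subset_compl.2 Set.subset_union_left))
    · exact Or.inr (hs.subset (Set.compl_subset_compl.2 Set.subset_union_left))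
  infClosed' := by
    rintro s (hs | hs) t (ht | ht)
    · exact Or.inl (hs.subset Set.inter_subset_left)
    · exact Or.inl (hs.subset Set.inter_subset_left)
    · exact Or.inl (ht.subset Set.inter_subset_right)
    · refine Or.inr ?_
      change ((s ∩ t)ᶜ).Finite
      rw [Set.compl_inter]
      exact hs.union ht
  compl_mem' := by
    rintro s (hs | hs)
    · exact Or.inr (by rwa [compl_compl])
    · exact Or.inl hs
  bot_mem' := Or.inl Set.finite_empty

/-- The free Boolean algebra on the generators `{p | p α = true}` (`α : κ`), in its standard
realization as the algebra of subsets of the Cantor cube `2^κ` generated by the coordinate sets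
(equivalently, the clopen algebra of `2^κ`). -/
def FreeBA (κ : Type u) : BooleanSubalgebra (Set (κ → Bool)) :=
  BooleanSubalgebra.closure (Set.range fun α : κ => {p : κ → Bool | p α = true})

/-- The first uncountable ordinal, as a type. -/
abbrev Omega1 : Type := (ω₁ : Ordinal.{0}).ToType

/-!
If `A` is `2`-free over `X`, every map `f : X → A` that preserves disjointness extends to an
endomorphism of `A`. For a finite `H ⊆ X` and a nonzero elementary product `e` over `X` that
involves all of `H`, suitable endomorphisms `φ` and `ψ` embed the interval below `e` into the
interval below `c`, the all-negative elementary product over `H`. Given `u : A`, choose `H` such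
that every elementary product over `H` lies below `u` or below `uᶜ`. Then `⊤` is a finite join of
pieces that all embed below one of `u` and `uᶜ`.

In `FinCo κ × FreeBA κ` with `κ` uncountable this fails for `u = (⊤, ⊥)`. Below `u`, one of any two
disjoint elements has only finitely many elements underneath, whereas some piece meets the atomless
factor `FreeBA κ`. Below `uᶜ`, the countable chain condition of `FreeBA κ` would pass to the whole
product, which has uncountably many atoms.

The product is nevertheless `3`-free over the pairs `(atom α, gen α)` together with `(⊤, ⊥)`,
because the only relations among these come from
`(⊤, ⊥) ⊓ (atom α, gen α) ⊓ (atom β, gen β) = ⊥` for `α ≠ β`.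
-/

section BooleanSubalgebras

variable {A : Type*} [BooleanAlgebra A] {S : BooleanSubalgebra A}

instance nontrivial_booleanSubalgebra [Nontrivial A] : Nontrivial S :=
  ⟨⊥, ⊤, fun h => bot_ne_top (congr_arg Subtype.val h)⟩

theorem disjoint_coe_iff {a b : S} : Disjoint (a : A) b ↔ Disjoint a b := by
  rw [disjoint_iff, disjoint_iff, ← BooleanSubalgebra.val_inf, ← BooleanSubalgebra.val_bot (L := S),
    Subtype.coe_inj]

theorem nonempty_coe_iff {κ : Type*} {S : BooleanSubalgebra (Set κ)} {a : S} :
    (a : Set κ).Nonempty ↔ a ≠ ⊥ := by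
  rw [Set.nonempty_iff_ne_empty, ← Set.bot_eq_empty, ← BooleanSubalgebra.val_bot (L := S),
    Subtype.coe_ne_coe]

end BooleanSubalgebras

section Generation

variable {A : Type u} {B : Type*} [BooleanAlgebra A] [BooleanAlgebra B] {X : Set A}

theorem GeneratesBA.mem_closure (hX : GeneratesBA X) (a : A) : a ∈ BooleanSubalgebra.closure X := by
  rw [show BooleanSubalgebra.closure X = ⊤ from hX]
  exact BooleanSubalgebra.mem_top

theorem generatesBA_of_forall_mem_closure (h : ∀ a, a ∈ BooleanSubalgebra.closure X) :
    GeneratesBA X :=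
  eq_top_iff.2 fun a _ => h a

theorem GeneratesBA.induction (hX : GeneratesBA X) {p : A → Prop} (mem : ∀ x ∈ X, p x) (bot : p ⊥)
    (sup : ∀ a b, p a → p b → p (a ⊔ b)) (compl : ∀ a, p a → p aᶜ) (a : A) : p a :=
  BooleanSubalgebra.closure_bot_sup_induction (p := fun a _ => p a) mem bot
    (fun a _ b _ => sup a b) (fun a _ => compl a) (hX.mem_closure a)

theorem GeneratesBA.inf_map_eq_inf_map (hX : GeneratesBA X) {g h : BoundedLatticeHom A B} {e : B}
    (hgh : ∀ x ∈ X, e ⊓ g x = e ⊓ h x) (a : A) : e ⊓ g a = e ⊓ h a := by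
  induction a using hX.induction with
  | mem x hx => exact hgh x hx
  | bot => simp only [map_bot]
  | sup a b ha hb => simp only [map_sup, inf_sup_left, ha, hb]
  | compl a ha =>
    rw [map_compl', map_compl', ← sdiff_eq, ← sdiff_inf_self_left, ha, sdiff_inf_self_left,
      sdiff_eq]

theorem GeneratesBA.hom_ext (hX : GeneratesBA X) {g h : BoundedLatticeHom A B}
    (hgh : ∀ x ∈ X, g x = h x) : g = h :=
  DFunLike.ext _ _ fun a => by
    simpa only [top_inf_eq] using
      hX.inf_map_eq_inf_map (e := ⊤) (fun x hx => congr_arg (⊤ ⊓ ·) (hgh x hx)) a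

theorem GeneratesBA.prod {B : Type u} [BooleanAlgebra B] {Y : Set B} {Z : Set (A × B)}
    (hX : GeneratesBA X) (hY : GeneratesBA Y) (hZ : (⊤, ⊥) ∈ Z) (hXZ : X ⊆ Prod.fst '' Z)
    (hYZ : Y ⊆ Prod.snd '' Z) : GeneratesBA Z := by
  set S := BooleanSubalgebra.closure Z
  have mem_of_mem {z} (hz : z ∈ Z) : z ∈ S := BooleanSubalgebra.subset_closure hz
  have fst_mem (a : A) : (a, ⊥) ∈ S := by
    induction a using hX.induction with
    | mem x hx =>
      obtain ⟨z, hz, rfl⟩ := hXZ hx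
      simpa [Prod.inf_def] using S.inf_mem (mem_of_mem hz) (mem_of_mem hZ)
    | bot => exact S.bot_mem
    | sup a b ha hb => simpa using S.sup_mem ha hb
    | compl a ha =>
      simpa [sdiff_eq, Prod.inf_def] using S.sdiff_mem (mem_of_mem hZ) ha
  have snd_mem (b : B) : (⊥, b) ∈ S := by
    induction b using hY.induction with
    | mem y hy =>
      obtain ⟨z, hz, rfl⟩ := hYZ hy
      simpa [sdiff_eq, Prod.inf_def] using S.sdiff_mem (mem_of_mem hz) (mem_of_mem hZ)
    | bot => exact S.bot_mem
    | sup a b ha hb => simpa using S.sup_mem ha hb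
    | compl b hb =>
      simpa [sdiff_eq, Prod.inf_def] using S.sdiff_mem (S.compl_mem (mem_of_mem hZ)) hb
  refine generatesBA_of_forall_mem_closure fun ⟨a, b⟩ => ?_
  simpa using S.sup_mem (fst_mem a) (snd_mem b)

end Generation

section ElementaryProducts

variable {ι A B : Type*} [BooleanAlgebra A] [BooleanAlgebra B] {v : ι → A} {w : ι → B}
  {F G : Finset ι} {a : A}

/-- The elementary product of the family `v` with positive part `F` and negative part `G`, that is
the meet of the `v i`, `i ∈ F`, and of the complements of the `v i`, `i ∈ G`. -/
def elementaryProduct (v : ι → A) (F G : Finset ι) : A := F.inf v ⊓ (G.sup v)ᶜ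

theorem le_elementaryProduct_iff :
    a ≤ elementaryProduct v F G ↔ (∀ i ∈ F, a ≤ v i) ∧ ∀ i ∈ G, Disjoint a (v i) := by
  simp only [elementaryProduct, le_inf_iff, Finset.le_inf_iff, le_compl_iff_disjoint_right,
    Finset.disjoint_sup_right]

theorem elementaryProduct_le {i : ι} (hi : i ∈ F) : elementaryProduct v F G ≤ v i :=
  (le_elementaryProduct_iff.1 le_rfl).1 i hi

theorem disjoint_elementaryProduct {i : ι} (hi : i ∈ G) :
    Disjoint (elementaryProduct v F G) (v i) :=
  (le_elementaryProduct_iff.1 le_rfl).2 i hi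

theorem elementaryProduct_eq_bot_of_mem {i : ι} (hF : i ∈ F) (hG : i ∈ G) :
    elementaryProduct v F G = ⊥ :=
  (disjoint_elementaryProduct hG).eq_bot_of_le (elementaryProduct_le hF)

theorem elementaryProduct_prodMk :
    elementaryProduct (fun i => (v i, w i)) F G =
      (elementaryProduct v F G, elementaryProduct w F G) := by
  refine eq_of_forall_le_iff fun ⟨a, b⟩ => ?_
  simp only [le_elementaryProduct_iff, Prod.mk_le_mk, Prod.disjoint_iff]
  grind

theorem map_elementaryProduct (g : BoundedLatticeHom A B) :
    g (elementaryProduct v F G) = elementaryProduct (g ∘ v) F G := by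
  simp only [elementaryProduct, map_inf, map_compl', map_finset_inf, map_finset_sup]

theorem mem_coe_elementaryProduct {κ : Type*} {S : BooleanSubalgebra (Set κ)} {v : ι → S} {p : κ} :
    p ∈ ((elementaryProduct v F G : S) : Set κ) ↔
      (∀ i ∈ F, p ∈ (v i : Set κ)) ∧ ∀ i ∈ G, p ∉ (v i : Set κ) := by
  rw [← BooleanSubalgebra.coe_subtype, map_elementaryProduct, ← Set.singleton_subset_iff,
    le_elementaryProduct_iff]
  simp

theorem exists_finset_elementaryProduct_sup_eq_top (v : ι → A) (H : Finset ι) :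
    ∃ T : Finset A, T.sup id = ⊤ ∧
      ∀ t ∈ T, ∃ F G : Finset ι, (∀ i ∈ H, i ∈ F ∨ i ∈ G) ∧ t = elementaryProduct v F G := by
  classical
  induction H using Finset.induction_on with
  | empty => exact ⟨{⊤}, by simp, fun t ht => ⟨∅, ∅, by simp_all [elementaryProduct]⟩⟩
  | insert i H _ ih =>
    obtain ⟨T, hT, hTH⟩ := ih
    refine ⟨T.image (v i ⊓ ·) ∪ T.image ((v i)ᶜ ⊓ ·), ?_, fun t ht => ?_⟩
    · have sup_inf (x : A) : T.sup (x ⊓ ·) = x := by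
        simpa [hT] using (Finset.sup_inf_distrib_left T id x).symm
      simp [Finset.sup_union, Finset.sup_image, sup_inf]
    · simp only [Finset.mem_union, Finset.mem_image] at ht
      obtain ⟨s, hs, rfl⟩ | ⟨s, hs, rfl⟩ := ht <;> obtain ⟨F, G, hFG, rfl⟩ := hTH s hs
      · exact ⟨insert i F, G, by grind, by simp [elementaryProduct, inf_assoc]⟩
      · exact ⟨F, insert i G, by grind, by simp [elementaryProduct, inf_left_comm]⟩

theorem exists_finset_elementaryProduct_decides
    (ha : a ∈ BooleanSubalgebra.closure (Set.range v)) :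
    ∃ H : Finset ι, ∀ F G : Finset ι, (∀ i ∈ H, i ∈ F ∨ i ∈ G) →
      elementaryProduct v F G ≤ a ∨ elementaryProduct v F G ≤ aᶜ := by
  classical
  induction ha using BooleanSubalgebra.closure_bot_sup_induction with
  | mem x hx =>
    obtain ⟨i, rfl⟩ := hx
    refine ⟨{i}, fun F G h => (h i (Finset.mem_singleton_self i)).imp elementaryProduct_le ?_⟩
    exact fun hi => (disjoint_elementaryProduct hi).le_compl_right
  | bot => exact ⟨∅, by simp⟩
  | sup a _ b _ iha ihb =>
    obtain ⟨H, hH⟩ := iha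
    obtain ⟨K, hK⟩ := ihb
    refine ⟨H ∪ K, fun F G hFG => ?_⟩
    obtain h | h := hH F G fun i hi => hFG i (Finset.mem_union_left _ hi)
    · exact .inl (h.trans le_sup_left)
    obtain k | k := hK F G fun i hi => hFG i (Finset.mem_union_right _ hi)
    · exact .inl (k.trans le_sup_right)
    · exact .inr (compl_sup.trans_ge (le_inf h k))
  | compl a _ ih =>
    obtain ⟨H, hH⟩ := ih
    exact ⟨H, fun F G hFG => by rw [compl_compl]; exact (hH F G hFG).symm⟩

theorem exists_not_disjoint_of_sup_eq_top {T : Finset A} (hT : T.sup id = ⊤) (ha : a ≠ ⊥) :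
    ∃ t ∈ T, ¬ Disjoint a t := by
  contrapose! ha
  rwa [← disjoint_top, ← hT, Finset.disjoint_sup_right]

theorem exists_elementaryProduct_le (ha : a ∈ BooleanSubalgebra.closure (Set.range v))
    (ha0 : a ≠ ⊥) :
    ∃ F G : Finset ι, elementaryProduct v F G ≠ ⊥ ∧ elementaryProduct v F G ≤ a := by
  obtain ⟨H, hH⟩ := exists_finset_elementaryProduct_decides ha
  obtain ⟨T, hT, hTH⟩ := exists_finset_elementaryProduct_sup_eq_top v H
  obtain ⟨t, ht, hat⟩ := exists_not_disjoint_of_sup_eq_top hT ha0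
  obtain ⟨F, G, hFG, rfl⟩ := hTH t ht
  refine ⟨F, G, fun h => hat (h ▸ disjoint_bot_right), (hH F G hFG).resolve_right fun h => hat ?_⟩
  exact (le_compl_iff_disjoint_right.1 h).symm

end ElementaryProducts

section Extension

variable {A : Type u} [BooleanAlgebra A]

theorem exists_hom_of_graph {A B : Type*} [BooleanAlgebra A] [BooleanAlgebra B]
    (Γ : BooleanSubalgebra (A × B)) (total : ∀ a, ∃ b, (a, b) ∈ Γ)
    (bot_of_bot : ∀ b, (⊥, b) ∈ Γ → b = ⊥) :
    ∃ g : BoundedLatticeHom A B, ∀ a b, (a, b) ∈ Γ → g a = b := by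
  have le_of_mem {a b c} (hb : (a, b) ∈ Γ) (hc : (a, c) ∈ Γ) : b ≤ c :=
    sdiff_eq_bot_iff.1 <| bot_of_bot _ <| by simpa [sdiff_eq, Prod.inf_def] using Γ.sdiff_mem hb hc
  have eq_of_mem {a b c} (hb : (a, b) ∈ Γ) (hc : (a, c) ∈ Γ) : b = c :=
    (le_of_mem hb hc).antisymm (le_of_mem hc hb)
  choose g hg using total
  exact ⟨{ toFun := g
           map_sup' := fun a b => eq_of_mem (hg _) (Γ.sup_mem (hg a) (hg b))
           map_inf' := fun a b => eq_of_mem (hg _) (Γ.inf_mem (hg a) (hg b))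
           map_top' := eq_of_mem (hg _) Γ.top_mem
           map_bot' := eq_of_mem (hg _) Γ.bot_mem }, fun a b hb => eq_of_mem (hg a) hb⟩

/-- Sikorski's extension criterion: the graph of the homomorphism is the subalgebra of `A × B`
generated by the pairs `(v i, w i)`. -/
theorem GeneratesBA.exists_hom_of_elementaryProduct {ι B : Type*} [BooleanAlgebra B] {v : ι → A}
    (hv : GeneratesBA (Set.range v)) (w : ι → B)
    (h : ∀ F G, elementaryProduct v F G = ⊥ → elementaryProduct w F G = ⊥) :
    ∃ g : BoundedLatticeHom A B, ∀ i, g (v i) = w i := by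
  set Γ := BooleanSubalgebra.closure (Set.range fun i => (v i, w i))
  have mem_graph (i : ι) : (v i, w i) ∈ Γ := BooleanSubalgebra.subset_closure ⟨i, rfl⟩
  have total (a : A) : ∃ b, (a, b) ∈ Γ := by
    induction a using hv.induction with
    | mem x hx =>
      obtain ⟨i, rfl⟩ := hx
      exact ⟨w i, mem_graph i⟩
    | bot => exact ⟨⊥, Γ.bot_mem⟩
    | sup a b ha hb =>
      obtain ⟨a', ha'⟩ := ha
      obtain ⟨b', hb'⟩ := hb
      exact ⟨a' ⊔ b', Γ.sup_mem ha' hb'⟩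
    | compl a ha =>
      obtain ⟨a', ha'⟩ := ha
      exact ⟨a'ᶜ, Γ.compl_mem ha'⟩
  have bot_of_bot (b : B) (hb : (⊥, b) ∈ Γ) : b = ⊥ := by
    by_contra hb0
    obtain ⟨F, G, hne, hle⟩ :=
      exists_elementaryProduct_le hb fun h0 => hb0 (congr_arg Prod.snd h0)
    rw [elementaryProduct_prodMk] at hne hle
    have hvFG : elementaryProduct v F G = ⊥ := le_bot_iff.1 hle.1
    exact hne (Prod.ext hvFG (h F G hvFG))
  obtain ⟨g, hg⟩ := exists_hom_of_graph Γ total bot_of_bot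
  exact ⟨g, fun i => hg _ _ (mem_graph i)⟩

end Extension

section Freeness

variable {A B : Type u} [BooleanAlgebra A] [BooleanAlgebra B] {ι : Type*} {n : ℕ}

theorem IsNPreserving.finset_inf_eq_bot {U : Set A} {f : U → B} (hf : IsNPreserving n f)
    {F : Finset ι} (hF : F.Nonempty) (hFn : F.card ≤ n) (s : ι → U)
    (h : F.inf (fun i => (s i : A)) = ⊥) : F.inf (fun i => f (s i)) = ⊥ := by
  classical
  have : Nonempty F := hF.to_subtype
  obtain ⟨e⟩ : Nonempty (F ↪ Fin n) := Function.Embedding.nonempty_of_card_le (by simpa using hFn)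
  let σ : Fin n → ι := fun k => (Function.invFun e k : F)
  have hσ : Finset.univ.image σ = F := by
    ext i
    simp only [Finset.mem_image, Finset.mem_univ, true_and]
    refine ⟨fun ⟨k, hk⟩ => hk ▸ (Function.invFun e k).2, fun hi => ?_⟩
    obtain ⟨k, hk⟩ := Function.invFun_surjective e.injective ⟨i, hi⟩
    exact ⟨k, congr_arg Subtype.val hk⟩
  rw [← hσ, Finset.inf_image] at h ⊢
  exact hf (s ∘ σ) h

theorem isNPreserving_two_iff {U : Set A} {f : U → B} :
    IsNPreserving 2 f ↔ ∀ x y : U, Disjoint (x : A) y → Disjoint (f x) (f y) := by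
  simp only [IsNPreserving, Fin.forall_fin_succ_pi, disjoint_iff]
  simp [Fin.univ_succ]

/-- The elements `v i` satisfy no relations except those that follow from the vanishing of meets of
at most `n` of them: with generation, this is a presentation that makes the algebra `n`-free. -/
def IsNPresented (n : ℕ) (v : ι → A) : Prop :=
  ∀ F G : Finset ι, Disjoint F G → elementaryProduct v F G = ⊥ →
    ∃ F' ⊆ F, F'.card ≤ n ∧ F'.inf v = ⊥

theorem IsNPresented.isNFreeOver [Nontrivial A] {v : ι → A} (h : IsNPresented n v)
    (hv : GeneratesBA (Set.range v)) : IsNFreeOver n (Set.range v) := by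
  intro B _ _ f hf
  let w : ι → B := fun i => f ⟨v i, i, rfl⟩
  have hvw (F G : Finset ι) (hFG : elementaryProduct v F G = ⊥) : elementaryProduct w F G = ⊥ := by
    by_cases hd : Disjoint F G
    · obtain ⟨F', hF', hcard, hinf⟩ := h F G hd hFG
      have hne : F'.Nonempty := by
        rw [Finset.nonempty_iff_ne_empty]
        rintro rfl
        exact top_ne_bot hinf
      have hw : F'.inf w = ⊥ := hf.finset_inf_eq_bot hne hcard (fun i => ⟨v i, i, rfl⟩) hinf
      exact le_bot_iff.1 (inf_le_left.trans ((Finset.inf_mono hF').trans_eq hw))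
    · obtain ⟨i, hF, hG⟩ := Finset.not_disjoint_iff.1 hd
      exact elementaryProduct_eq_bot_of_mem hF hG
  obtain ⟨g, hg⟩ := hv.exists_hom_of_elementaryProduct w hvw
  refine ⟨g, fun ⟨_, i, hi⟩ => by subst hi; exact hg i, fun g' hg' => hv.hom_ext ?_⟩
  rintro _ ⟨i, rfl⟩
  exact (hg' ⟨v i, i, rfl⟩).trans (hg i).symm

theorem IsNIndependent.isNPresented [Nontrivial A] {X : Set A} (h : IsNIndependent n X) :
    IsNPresented n (Subtype.val : X → A) := by
  classical
  intro F G hFG hbot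
  have inf_le : F.inf Subtype.val ≤ G.sup Subtype.val :=
    disjoint_compl_right_iff.1 (disjoint_iff.2 hbot)
  have indep (F G : Finset X) (hF : F.Nonempty) (hG : G.Nonempty) :=
    h.2 (F.image (↑)) (G.image (↑)) (hF.image _) (hG.image _) (by simp) (by simp)
  simp only [Finset.sup_image, Finset.inf_image, Function.id_comp] at indep
  have sup_ne_top : G.sup Subtype.val ≠ ⊤ := by
    obtain rfl | hG := G.eq_empty_or_nonempty
    · exact bot_ne_top
    · exact (indep G G hG hG).1
  obtain rfl | hF := F.eq_empty_or_nonempty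
  · exact absurd (top_le_iff.1 inf_le) sup_ne_top
  have inf_eq_bot : F.inf Subtype.val = ⊥ := by
    by_contra hne
    obtain rfl | hG := G.eq_empty_or_nonempty
    · exact hne (le_bot_iff.1 inf_le)
    obtain ⟨x, hxF, hxG⟩ := (indep F G hF hG).2.2 hne inf_le
    exact Finset.disjoint_left.1 ((Finset.disjoint_image Subtype.val_injective).2 hFG) hxF hxG
  obtain ⟨_, hsub, hcard, hbot'⟩ := (indep F F hF hF).2.1 inf_eq_bot
  obtain ⟨F', hF', rfl⟩ := Finset.subset_image_iff.1 hsub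
  rw [Finset.card_image_of_injective _ Subtype.val_injective] at hcard
  exact ⟨F', hF', hcard, by rwa [Finset.inf_image] at hbot'⟩

theorem IsNIndependent.isNFreeOver [Nontrivial A] {X : Set A} (h : IsNIndependent n X)
    (hX : GeneratesBA X) : IsNFreeOver n X := by
  simpa using h.isNPresented.isNFreeOver (by simpa using hX)

theorem IsNFreeOver.generatesBA [Nontrivial A] {X : Set A} (h : IsNFreeOver n X) :
    GeneratesBA X := by
  set S := BooleanSubalgebra.closure X
  let inclusion (x : X) : S := ⟨x, BooleanSubalgebra.subset_closure x.2⟩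
  obtain ⟨r, hr, -⟩ := h S inclusion fun a ha => Subtype.ext <|
    (map_finset_inf S.subtype Finset.univ (inclusion ∘ a)).trans ha
  have hretract : S.subtype.comp r = BoundedLatticeHom.id A :=
    (h A (fun x => x) fun _ ha => ha).unique (fun x => congr_arg Subtype.val (hr x)) fun _ => rfl
  refine generatesBA_of_forall_mem_closure fun a => ?_
  rw [← show (r a : A) = a from DFunLike.congr_fun hretract a]
  exact (r a).2

end Freeness

section RelativeEmbeddings

/-- The interval below `t` embeds into the interval below `w` through an endomorphism `φ` of the
algebra, by way of `a ↦ φ a ⊓ w`. For such a map injectivity amounts to having trivial kernel. -/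
def RelativelyEmbeds {A : Type*} [BooleanAlgebra A] (t w : A) : Prop :=
  ∃ φ : BoundedLatticeHom A A, ∀ a, Disjoint (φ a) w → Disjoint a t

variable {A : Type u} [BooleanAlgebra A] {X : Set A} {n : ℕ}

theorem RelativelyEmbeds.mono_right {t w w' : A} (h : RelativelyEmbeds t w) (hw : w ≤ w') :
    RelativelyEmbeds t w' :=
  let ⟨φ, hφ⟩ := h
  ⟨φ, fun a ha => hφ a (ha.mono_right hw)⟩

theorem RelativelyEmbeds.bot_left (w : A) : RelativelyEmbeds ⊥ w :=
  ⟨BoundedLatticeHom.id A, fun _ _ => disjoint_bot_right⟩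

theorem IsNFreeOver.exists_hom_of_le [Nontrivial A] (h : IsNFreeOver n X) (f : X → A)
    (hf : ∀ x, f x ≤ x) : ∃ φ : BoundedLatticeHom A A, ∀ x : X, φ x = f x :=
  (h A f fun _ ha => le_bot_iff.1 <| (Finset.inf_mono_fun fun _ _ => hf _).trans_eq ha).exists

theorem IsNFreeOver.exists_hom_sup_sdiff [Nontrivial A] (h : IsNFreeOver 2 X) {E : Set X}
    (hE : ∀ x ∈ E, ∀ y ∈ E, ¬ Disjoint (x : A) y) (c : A) :
    ∃ φ : BoundedLatticeHom A A, ∀ x : X, (x ∈ E → φ x = ↑x ⊔ c) ∧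
      ((∃ y ∈ E, Disjoint (x : A) y) → φ x = ↑x \ c) ∧
      (x ∉ E → (∀ y ∈ E, ¬ Disjoint (x : A) y) → φ x = x) := by
  classical
  let f (x : X) : A := if x ∈ E then x ⊔ c else if ∃ y ∈ E, Disjoint (x : A) y then x \ c else x
  have f_sup {x} (hx : x ∈ E) : f x = ↑x ⊔ c := if_pos hx
  have f_sdiff {x : X} (hx : ∃ y ∈ E, Disjoint (x : A) y) : f x = ↑x \ c :=
    (if_neg fun hxE => let ⟨y, hy, hxy⟩ := hx; hE x hxE y hy hxy).trans (if_pos hx)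
  have f_le {x} (hx : x ∉ E) : f x ≤ x := by
    simp only [f, if_neg hx]
    split_ifs
    exacts [sdiff_le, le_rfl]
  have disjoint_of_mem {x y : X} (hx : x ∈ E) (hxy : Disjoint (x : A) y) :
      Disjoint (f x) (f y) := by
    rw [f_sup hx, f_sdiff ⟨x, hx, hxy.symm⟩]
    exact disjoint_sup_left.2 ⟨hxy.mono_right sdiff_le, disjoint_sdiff_self_right⟩
  obtain ⟨φ, hφ, -⟩ := h A f <| isNPreserving_two_iff.2 fun x y hxy => by
    by_cases hx : x ∈ E
    · exact disjoint_of_mem hx hxy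
    by_cases hy : y ∈ E
    · exact (disjoint_of_mem hy hxy.symm).symm
    · exact hxy.mono (f_le hx) (f_le hy)
  refine ⟨φ, fun x => ?_⟩
  rw [hφ]
  exact ⟨f_sup, f_sdiff, fun hx hx' => (if_neg hx).trans <| if_neg fun ⟨y, hy, hxy⟩ => hx' y hy hxy⟩

theorem IsNFreeOver.exists_hom_inf_comp_eq [Nontrivial A] (h : IsNFreeOver 2 X)
    {E G H : Finset X} (hH : ∀ x ∈ H, x ∈ E ∨ x ∈ G) {c e : A}
    (hc : c = elementaryProduct (↑) ∅ H) (he : e = elementaryProduct (↑) E G) (he0 : e ≠ ⊥) :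
    ∃ φ ψ : BoundedLatticeHom A A, e ≤ ψ c ∧ ∀ a, e ⊓ ψ (φ a) = e ⊓ a := by
  classical
  have e_le {x : X} (hx : x ∈ E) : e ≤ x := he.trans_le (elementaryProduct_le hx)
  -- `φ` adds `c` to the positive factors of `e`; `ψ` makes all of `H` disjoint from `e`, so that
  -- `e ≤ ψ c`, and hence below `e` the map `ψ` undoes `φ`.
  obtain ⟨φ, hφ⟩ := h.exists_hom_sup_sdiff (E := (E : Set X))
    (fun x hx y hy hxy => he0 <| le_bot_iff.1 <| hxy (e_le hx) (e_le hy)) c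
  obtain ⟨ψ, hψ⟩ := h.exists_hom_of_le (fun x => if x ∈ H then ↑x \ e else ↑x) fun x => by
    split_ifs
    exacts [sdiff_le, le_rfl]
  have le_ψc : e ≤ ψ c := by
    rw [hc, map_elementaryProduct, le_elementaryProduct_iff]
    refine ⟨by simp, fun x hx => ?_⟩
    rw [Function.comp_apply, hψ, if_pos hx]
    exact disjoint_sdiff_self_right
  refine ⟨φ, ψ, le_ψc, h.generatesBA.inf_map_eq_inf_map (g := ψ.comp φ) (h := .id A) fun x hx => ?_⟩
  lift x to X using hx
  change e ⊓ ψ (φ x) = e ⊓ x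
  obtain ⟨φ_of_mem, φ_of_disjoint, φ_of_not_disjoint⟩ := hφ x
  by_cases hxE : x ∈ E
  · rw [φ_of_mem hxE, map_sup, inf_eq_left.2 (le_ψc.trans le_sup_right), inf_eq_left.2 (e_le hxE)]
  by_cases hdisj : ∃ y ∈ E, Disjoint (x : A) y
  · obtain ⟨y, hy, hxy⟩ := hdisj
    rw [φ_of_disjoint ⟨y, hy, hxy⟩, map_sdiff', (hxy.symm.mono_left (e_le hy)).eq_bot]
    exact (disjoint_sdiff_self_right.mono_left le_ψc).eq_bot
  rw [φ_of_not_disjoint hxE fun y hy hxy => hdisj ⟨y, hy, hxy⟩, hψ]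
  split_ifs with hxH
  · have hex : Disjoint e x := he ▸ disjoint_elementaryProduct ((hH x hxH).resolve_left hxE)
    rw [disjoint_sdiff_self_right.eq_bot, hex.eq_bot]
  · rfl

theorem IsNFreeOver.relativelyEmbeds_elementaryProduct [Nontrivial A] (h : IsNFreeOver 2 X)
    {E G H : Finset X} (hH : ∀ x ∈ H, x ∈ E ∨ x ∈ G) :
    RelativelyEmbeds (elementaryProduct ((↑) : X → A) E G) (elementaryProduct (↑) ∅ H) := by
  obtain he0 | he0 := eq_or_ne (elementaryProduct ((↑) : X → A) E G) ⊥
  · exact he0 ▸ .bot_left _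
  obtain ⟨φ, ψ, le_ψ, inf_ψφ⟩ := h.exists_hom_inf_comp_eq hH rfl rfl he0
  refine ⟨φ, fun a ha => ?_⟩
  have hψ : Disjoint (ψ (φ a)) (ψ (elementaryProduct (↑) ∅ H)) := ha.map ψ
  rw [disjoint_comm, disjoint_iff, ← inf_ψφ a, ← disjoint_iff]
  exact (hψ.mono_right le_ψ).symm

theorem IsNFree.exists_finset_relativelyEmbeds [Nontrivial A] (h : IsNFree 2 A) (u : A) :
    ∃ w, (w = u ∨ w = uᶜ) ∧ ∃ T : Finset A, T.sup id = ⊤ ∧ ∀ t ∈ T, RelativelyEmbeds t w := by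
  obtain ⟨X, hX⟩ := h
  obtain ⟨H, hH⟩ := exists_finset_elementaryProduct_decides (v := ((↑) : X → A)) (a := u)
    (by simpa using hX.generatesBA.mem_closure u)
  obtain ⟨w, hw, hle⟩ : ∃ w, (w = u ∨ w = uᶜ) ∧ elementaryProduct ((↑) : X → A) ∅ H ≤ w :=
    (hH ∅ H fun x hx => .inr hx).elim (fun hle => ⟨u, .inl rfl, hle⟩) fun hle => ⟨uᶜ, .inr rfl, hle⟩
  obtain ⟨T, hT, hTH⟩ := exists_finset_elementaryProduct_sup_eq_top ((↑) : X → A) H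
  refine ⟨w, hw, T, hT, fun t ht => ?_⟩
  obtain ⟨E, G, hEG, rfl⟩ := hTH t ht
  exact (hX.relativelyEmbeds_elementaryProduct hEG).mono_right hle

end RelativeEmbeddings

section ChainConditionsAndAtoms

/-- The countable chain condition: every family of nonzero pairwise disjoint elements is
countable. -/
def CountableChainCondition (A : Type*) [BooleanAlgebra A] : Prop :=
  ∀ S : Set A, ⊥ ∉ S → S.PairwiseDisjoint id → S.Countable

variable {A B : Type*} [BooleanAlgebra A] [BooleanAlgebra B]

theorem CountableChainCondition.countable_of_pairwiseDisjoint (hA : CountableChainCondition A)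
    {ι : Type*} {s : Set ι} {f : ι → A} (hf : s.PairwiseDisjoint f) (hf0 : ∀ i ∈ s, f i ≠ ⊥) :
    s.Countable := by
  refine Set.countable_of_injective_of_countable_image (f := f) (fun i hi j hj hij => ?_) <|
    hA (f '' s) (fun ⟨i, hi, h⟩ => hf0 i hi h) ?_
  · by_contra hne
    have hdisj : Disjoint (f i) (f j) := hf hi hj hne
    exact hf0 i hi (disjoint_self.1 (hij ▸ hdisj))
  · rintro _ ⟨i, hi, rfl⟩ _ ⟨j, hj, rfl⟩ hij
    exact hf hi hj fun h => hij (congr_arg f h)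

theorem CountableChainCondition.fst (h : CountableChainCondition (A × B)) :
    CountableChainCondition A := fun S hS0 hS =>
  h.countable_of_pairwiseDisjoint (f := fun a => (a, ⊥))
    (fun _ ha _ hb hab => Prod.disjoint_iff.2 ⟨hS ha hb hab, disjoint_bot_left⟩)
    fun a ha ha0 => by
      obtain rfl : a = ⊥ := congr_arg Prod.fst ha0
      exact hS0 ha

theorem CountableChainCondition.of_relativelyEmbeds (hB : CountableChainCondition B)
    {T : Finset (A × B)} (hT : T.sup id = ⊤) (h : ∀ t ∈ T, RelativelyEmbeds t (⊥, ⊤)) :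
    CountableChainCondition (A × B) := fun S hS0 hS => by
  have meeting_countable (t) (ht : t ∈ T) : {a ∈ S | ¬ Disjoint a t}.Countable := by
    obtain ⟨φ, hφ⟩ := h t ht
    refine hB.countable_of_pairwiseDisjoint (f := fun a => (φ a).2) (fun a ha b hb hab => ?_) ?_
    · exact (Prod.disjoint_iff.1 ((hS ha.1 hb.1 hab).map φ)).2
    · exact fun a ha ha0 => ha.2 (hφ a (Prod.disjoint_iff.2 (by simp [ha0])))
  refine (T.countable_toSet.biUnion meeting_countable).mono fun a ha => ?_
  obtain ⟨t, ht, hat⟩ := exists_not_disjoint_of_sup_eq_top hT fun h0 : a = ⊥ => hS0 (h0 ▸ ha)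
  exact Set.mem_biUnion ht ⟨ha, hat⟩

theorem exists_isAtom_of_finite_Iic {a : A} (ha : a ≠ ⊥) (hfin : (Set.Iic a).Finite) :
    ∃ b : A, IsAtom b := by
  have := hfin.to_subtype
  obtain h | ⟨b, hb, -⟩ := IsAtomic.eq_bot_or_exists_atom_le (⟨a, le_rfl⟩ : Set.Iic a)
  · exact absurd (congr_arg Subtype.val h) ha
  · exact ⟨b, hb.of_isAtom_coe_Iic⟩

theorem RelativelyEmbeds.exists_injOn {t w : A} (h : RelativelyEmbeds t w) :
    ∃ φ : BoundedLatticeHom A A, Set.InjOn (φ · ⊓ w) (Set.Iic t) := by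
  obtain ⟨φ, hφ⟩ := h
  have le_of_eq {a b : A} (ha : a ≤ t) (hab : φ a ⊓ w = φ b ⊓ w) : a ≤ b := by
    refine sdiff_eq_bot_iff.1 <| (hφ (a \ b) ?_).eq_bot_of_le (sdiff_le.trans ha)
    rw [map_sdiff', disjoint_iff, inf_comm, ← inf_sdiff_assoc, inf_comm, hab]
    simp
  exact ⟨φ, fun a ha b hb hab => (le_of_eq ha hab).antisymm (le_of_eq hb hab.symm)⟩

theorem RelativelyEmbeds.snd_eq_bot
    (hfin : ∀ x y : A, Disjoint x y → (Set.Iic x).Finite ∨ (Set.Iic y).Finite)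
    (hatom : ∀ b : B, ¬ IsAtom b) {t : A × B} (h : RelativelyEmbeds t (⊤, ⊥)) : t.2 = ⊥ := by
  obtain ⟨φ, hφ⟩ := h.exists_injOn
  have eq_bot_of_finite {b : B} (hb : b ≤ t.2) (hfin : (Set.Iic (φ (⊥, b)).1).Finite) : b = ⊥ := by
    by_contra hb0
    have maps_to : Set.MapsTo (fun c => φ (⊥, c) ⊓ (⊤, ⊥)) (Set.Iic b)
        (Set.Iic (φ (⊥, b)).1 ×ˢ {⊥}) := by
      intro c hc
      have : φ (⊥, c) ≤ φ (⊥, b) := OrderHomClass.mono φ ⟨le_rfl, hc⟩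
      simpa using this.1
    have inj_on : Set.InjOn (fun c => φ (⊥, c) ⊓ (⊤, ⊥)) (Set.Iic b) := fun c hc d hd hcd =>
      congr_arg Prod.snd <| hφ (⟨bot_le, le_trans hc hb⟩ : (⊥, c) ≤ t)
        (⟨bot_le, le_trans hd hb⟩ : (⊥, d) ≤ t) hcd
    obtain ⟨a, ha⟩ := exists_isAtom_of_finite_Iic hb0 <|
      Set.Finite.of_injOn maps_to inj_on (hfin.prod (Set.finite_singleton ⊥))
    exact hatom a ha
  by_contra ht
  obtain ⟨b, hbt, hb⟩ : ∃ b < t.2, b ≠ ⊥ := by simpa [IsAtom, ht] using hatom t.2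
  have hdisj : Disjoint (φ (⊥, b)) (φ (⊥, t.2 \ b)) :=
    Disjoint.map φ (Prod.disjoint_iff.2 ⟨disjoint_bot_left, disjoint_sdiff_self_right⟩)
  obtain h | h := hfin _ _ (Prod.disjoint_iff.1 hdisj).1
  · exact hb (eq_bot_of_finite hbt.le h)
  · exact hbt.not_ge (sdiff_eq_bot_iff.1 (eq_bot_of_finite sdiff_le h))

theorem not_isNFree_two_prod {A B : Type u} [BooleanAlgebra A] [BooleanAlgebra B] [Nontrivial B]
    (hA : ¬ CountableChainCondition A)
    (hfin : ∀ x y : A, Disjoint x y → (Set.Iic x).Finite ∨ (Set.Iic y).Finite)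
    (hB : CountableChainCondition B) (hatom : ∀ b : B, ¬ IsAtom b) : ¬ IsNFree 2 (A × B) := by
  intro h
  obtain ⟨w, rfl | rfl, T, hT, hTw⟩ := h.exists_finset_relativelyEmbeds (⊤, ⊥)
  · have le_top_bot : T.sup id ≤ (⊤, ⊥) :=
      Finset.sup_le fun t ht => ⟨le_top, ((hTw t ht).snd_eq_bot hfin hatom).le⟩
    exact top_ne_bot (top_le_iff.1 (hT ▸ le_top_bot).2).symm
  · have compl_eq : ((⊤, ⊥) : A × B)ᶜ = (⊥, ⊤) := Prod.ext compl_top compl_bot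
    exact hA (hB.of_relativelyEmbeds hT (compl_eq ▸ hTw)).fst

end ChainConditionsAndAtoms

namespace FinCo

variable {κ : Type u}

/-- The singleton `{α}` as an element of `FinCo κ`. -/
def atom (α : κ) : FinCo κ := ⟨{α}, .inl (Set.finite_singleton α)⟩

theorem atom_ne_bot (α : κ) : atom α ≠ ⊥ := nonempty_coe_iff.1 (Set.singleton_nonempty α)

theorem disjoint_atom {α β : κ} (h : α ≠ β) : Disjoint (atom α) (atom β) :=
  disjoint_coe_iff.1 (Set.disjoint_singleton.2 h)

theorem generatesBA_range_atom : GeneratesBA (Set.range (atom (κ := κ))) := by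
  have mem_of_finite (s : Set κ) (hs : s.Finite) :
      (⟨s, .inl hs⟩ : FinCo κ) ∈ BooleanSubalgebra.closure (Set.range atom) := by
    induction s, hs using Set.Finite.induction_on with
    | empty => exact BooleanSubalgebra.bot_mem
    | @insert α s _ hs ih =>
      exact BooleanSubalgebra.sup_mem (BooleanSubalgebra.subset_closure (Set.mem_range_self α)) ih
  refine generatesBA_of_forall_mem_closure fun ⟨s, hs⟩ => ?_
  obtain hs | hs := hs
  · exact mem_of_finite s hs
  · exact BooleanSubalgebra.compl_mem_iff.1 (mem_of_finite sᶜ hs)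

theorem one_lt_card_of_elementaryProduct_eq_bot [Infinite κ] {F G : Finset κ} (hFG : Disjoint F G)
    (h : elementaryProduct atom F G = ⊥) : 1 < F.card := by
  by_contra! hF
  obtain ⟨α, hα⟩ : ∃ α, (∀ β ∈ F, α = β) ∧ α ∉ G := by
    obtain rfl | ⟨α, hα⟩ := F.eq_empty_or_nonempty
    · obtain ⟨α, hα⟩ := Infinite.exists_notMem_finset G
      exact ⟨α, by simp, hα⟩
    · exact ⟨α, fun β hβ => Finset.card_le_one.1 hF α hα β hβ, Finset.disjoint_left.1 hFG hα⟩
  have mem : α ∈ ((elementaryProduct atom F G : FinCo κ) : Set κ) :=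
    mem_coe_elementaryProduct.2 ⟨hα.1, fun β hβ hαβ => hα.2 (Set.mem_singleton_iff.1 hαβ ▸ hβ)⟩
  rw [h] at mem
  exact mem

theorem isNPresented_two_atom [Infinite κ] : IsNPresented 2 (atom (κ := κ)) := by
  classical
  intro F G hFG h
  obtain ⟨α, hα, β, hβ, hαβ⟩ :=
    Finset.one_lt_card.1 (one_lt_card_of_elementaryProduct_eq_bot hFG h)
  exact ⟨{α, β}, by grind, Finset.card_le_two, by simpa using (disjoint_atom hαβ).eq_bot⟩

theorem isNFree_two [Infinite κ] : IsNFree 2 (FinCo κ) :=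
  ⟨_, isNPresented_two_atom.isNFreeOver generatesBA_range_atom⟩

theorem not_countableChainCondition [Uncountable κ] : ¬ CountableChainCondition (FinCo κ) := by
  intro h
  have : (Set.univ : Set κ).Countable :=
    h.countable_of_pairwiseDisjoint (fun _ _ _ _ => disjoint_atom) fun α _ => atom_ne_bot α
  exact Set.not_countable_univ this

theorem finite_Iic {s : FinCo κ} (hs : (s : Set κ).Finite) : (Set.Iic s).Finite :=
  Set.Finite.of_injOn (f := ((↑) : FinCo κ → Set κ)) (fun _ ht => ht)
    Subtype.val_injective.injOn hs.finite_subsets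

theorem finite_Iic_or_finite_Iic_of_disjoint {s t : FinCo κ} (h : Disjoint s t) :
    (Set.Iic s).Finite ∨ (Set.Iic t).Finite :=
  s.2.imp finite_Iic fun hs =>
    finite_Iic (hs.subset (Set.subset_compl_iff_disjoint_left.2 (disjoint_coe_iff.2 h)))

end FinCo

namespace FreeBA

variable {κ : Type u}

/-- The generator of `FreeBA κ` given by the coordinate `α`. -/
def gen (α : κ) : FreeBA κ := ⟨{p | p α = true}, BooleanSubalgebra.subset_closure ⟨α, rfl⟩⟩

theorem generatesBA_range_gen : GeneratesBA (Set.range (gen (κ := κ))) := by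
  refine generatesBA_of_forall_mem_closure fun ⟨a, ha⟩ => ?_
  induction ha using BooleanSubalgebra.closure_bot_sup_induction with
  | mem x hx =>
    obtain ⟨α, rfl⟩ := hx
    exact BooleanSubalgebra.subset_closure ⟨α, rfl⟩
  | bot => exact BooleanSubalgebra.bot_mem
  | sup x _ y _ ihx ihy => exact BooleanSubalgebra.sup_mem ihx ihy
  | compl x _ ih => exact BooleanSubalgebra.compl_mem ih

theorem elementaryProduct_gen_ne_bot {F G : Finset κ} (hFG : Disjoint F G) :
    elementaryProduct gen F G ≠ ⊥ := by
  classical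
  refine nonempty_coe_iff.1 ⟨fun α => decide (α ∈ F), mem_coe_elementaryProduct.2 ⟨?_, ?_⟩⟩
  · exact fun α hα => decide_eq_true hα
  · exact fun α hα h => Finset.disjoint_left.1 hFG (of_decide_eq_true h) hα

theorem isNPresented_gen (n : ℕ) : IsNPresented n (gen (κ := κ)) := fun _ _ hFG h =>
  absurd h (elementaryProduct_gen_ne_bot hFG)

theorem isNFree (n : ℕ) : IsNFree n (FreeBA κ) :=
  ⟨_, (isNPresented_gen n).isNFreeOver generatesBA_range_gen⟩

theorem exists_elementaryProduct_gen_le {a : FreeBA κ} (ha : a ≠ ⊥) :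
    ∃ F G : Finset κ, Disjoint F G ∧ elementaryProduct gen F G ≤ a := by
  obtain ⟨F, G, hne, hle⟩ := exists_elementaryProduct_le (generatesBA_range_gen.mem_closure a) ha
  refine ⟨F, G, Finset.disjoint_left.2 fun α hF hG => hne ?_, hle⟩
  exact elementaryProduct_eq_bot_of_mem hF hG

theorem not_isAtom [Infinite κ] (a : FreeBA κ) : ¬ IsAtom a := by
  classical
  intro ha
  obtain ⟨F, G, hFG, hle⟩ := exists_elementaryProduct_gen_le ha.ne_bot
  obtain ⟨α, hα⟩ := Infinite.exists_notMem_finset (F ∪ G)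
  rw [Finset.notMem_union] at hα
  have eq_of_subset {F' G'} (hF : F ⊆ F') (hG : G ⊆ G') (h : Disjoint F' G') :
      elementaryProduct gen F' G' = a := by
    refine (ha.le_iff_eq (elementaryProduct_gen_ne_bot h)).1 (le_trans ?_ hle)
    exact inf_le_inf (Finset.inf_mono hF) (compl_le_compl (Finset.sup_mono hG))
  have le_gen : a ≤ gen α := by
    rw [← eq_of_subset (Finset.subset_insert α F) subset_rfl (by grind)]
    exact elementaryProduct_le (Finset.mem_insert_self α F)
  have disjoint_gen : Disjoint a (gen α) := by
    rw [← eq_of_subset subset_rfl (Finset.subset_insert α G) (by grind)]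
    exact disjoint_elementaryProduct (Finset.mem_insert_self α G)
  exact ha.ne_bot (disjoint_gen.eq_bot_of_le le_gen)

/-- The fair coin-tossing measure on the Cantor cube. Being a probability measure that is positive
on the nonzero elements of `FreeBA κ`, it witnesses the countable chain condition. -/
noncomputable def coinMeasure (κ : Type u) : MeasureTheory.Measure (κ → Bool) :=
  .infinitePi fun _ => (PMF.uniformOfFintype Bool).toMeasure

instance isProbabilityMeasure_coinMeasure : MeasureTheory.IsProbabilityMeasure (coinMeasure κ) :=
  inferInstanceAs (MeasureTheory.IsProbabilityMeasure (.infinitePi _))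

theorem measurableSet_coe (a : FreeBA κ) : MeasurableSet (a : Set (κ → Bool)) := by
  induction a using generatesBA_range_gen.induction with
  | mem x hx =>
    obtain ⟨α, rfl⟩ := hx
    exact measurableSet_eq_fun (measurable_pi_apply α) measurable_const
  | bot => exact .empty
  | sup a b ha hb => exact ha.union hb
  | compl a ha => exact ha.compl

theorem coinMeasure_pos {a : FreeBA κ} (ha : a ≠ ⊥) : 0 < coinMeasure κ a := by
  classical
  obtain ⟨F, G, hFG, hle⟩ := exists_elementaryProduct_gen_le ha
  have pi_subset : Set.pi ↑(F ∪ G) (fun α => {decide (α ∈ F)}) ⊆ (a : Set (κ → Bool)) := by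
    intro p hp
    have apply_eq {α} (hα : α ∈ F ∪ G) : p α = decide (α ∈ F) := hp α hα
    refine hle (mem_coe_elementaryProduct.2 ⟨fun α hα => ?_, fun α hα => ?_⟩)
    · simp [gen, apply_eq (Finset.mem_union_left G hα), hα]
    · simp [gen, apply_eq (Finset.mem_union_right F hα), Finset.disjoint_right.1 hFG hα]
  refine lt_of_lt_of_le ?_ (MeasureTheory.measure_mono pi_subset)
  rw [coinMeasure, MeasureTheory.Measure.infinitePi_pi _ fun _ _ => .singleton _]
  simp [pos_iff_ne_zero, Finset.prod_ne_zero_iff]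

theorem countableChainCondition : CountableChainCondition (FreeBA κ) := by
  intro S hS0 hS
  have hcount := MeasureTheory.Measure.countable_meas_pos_of_disjoint_iUnion (μ := coinMeasure κ)
    (As := fun a : S => ((a : FreeBA κ) : Set (κ → Bool))) (fun a => measurableSet_coe a.1)
    fun a b hab => disjoint_coe_iff.2 (hS a.2 b.2 (Subtype.val_injective.ne hab))
  have hpos (a : S) : 0 < coinMeasure κ a.1 := coinMeasure_pos fun h => hS0 (h ▸ a.2)
  simpa [hpos, Set.countable_univ_iff] using hcount

end FreeBA

section FinCoProdFreeBA

variable {κ : Type u}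

/-- A generating family of `FinCo κ × FreeBA κ`: the pairs of an atom and a free generator with the
same index, together with the element `(⊤, ⊥)` that separates the factors. -/
def finCoProdFreeBAGen : Option κ → FinCo κ × FreeBA κ :=
  fun i => (i.elim ⊤ FinCo.atom, i.elim ⊥ FreeBA.gen)

theorem generatesBA_range_finCoProdFreeBAGen :
    GeneratesBA (Set.range (finCoProdFreeBAGen (κ := κ))) := by
  refine FinCo.generatesBA_range_atom.prod FreeBA.generatesBA_range_gen ⟨none, rfl⟩ ?_ ?_
  · rintro _ ⟨α, rfl⟩
    exact ⟨_, ⟨some α, rfl⟩, rfl⟩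
  · rintro _ ⟨α, rfl⟩
    exact ⟨_, ⟨some α, rfl⟩, rfl⟩

theorem isNPresented_three_finCoProdFreeBAGen [Infinite κ] :
    IsNPresented 3 (finCoProdFreeBAGen (κ := κ)) := by
  classical
  intro F G hFG hbot
  obtain ⟨hFinCo, hFreeBA⟩ : elementaryProduct (Option.elim · ⊤ FinCo.atom) F G = ⊥ ∧
      elementaryProduct (Option.elim · ⊥ FreeBA.gen) F G = ⊥ :=
    Prod.ext_iff.1 (elementaryProduct_prodMk.symm.trans hbot)
  have disjoint_eraseNone : Disjoint F.eraseNone G.eraseNone :=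
    Finset.disjoint_left.2 fun α hF hG =>
      Finset.disjoint_left.1 hFG (Finset.mem_eraseNone.1 hF) (Finset.mem_eraseNone.1 hG)
  have none_mem : none ∈ F := by
    by_contra hnone
    refine FreeBA.elementaryProduct_gen_ne_bot disjoint_eraseNone
      (le_bot_iff.1 (hFreeBA ▸ le_elementaryProduct_iff.2 ?_))
    simp +contextual [Option.forall, elementaryProduct_le, disjoint_elementaryProduct, hnone]
  have atom_eq_bot : elementaryProduct FinCo.atom F.eraseNone G.eraseNone = ⊥ := by
    refine le_bot_iff.1 (hFinCo ▸ le_elementaryProduct_iff.2 ?_)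
    simp +contextual [Option.forall, elementaryProduct_le, disjoint_elementaryProduct,
      Finset.disjoint_left.1 hFG none_mem]
  obtain ⟨α, hα, β, hβ, hαβ⟩ := Finset.one_lt_card.1
    (FinCo.one_lt_card_of_elementaryProduct_eq_bot disjoint_eraseNone atom_eq_bot)
  refine ⟨{none, some α, some β}, by grind [Finset.mem_eraseNone], Finset.card_le_three, ?_⟩
  simp [finCoProdFreeBAGen, (FinCo.disjoint_atom hαβ).eq_bot, Prod.ext_iff]

theorem isNFree_three_finCo_prod_freeBA [Infinite κ] : IsNFree 3 (FinCo κ × FreeBA κ) :=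
  ⟨_, isNPresented_three_finCoProdFreeBAGen.isNFreeOver generatesBA_range_finCoProdFreeBAGen⟩

theorem not_isNFree_two_finCo_prod_freeBA [Uncountable κ] : ¬ IsNFree 2 (FinCo κ × FreeBA κ) :=
  not_isNFree_two_prod FinCo.not_countableChainCondition
    (fun _ _ => FinCo.finite_Iic_or_finite_Iic_of_disjoint) FreeBA.countableChainCondition
    FreeBA.not_isAtom

end FinCoProdFreeBA

instance uncountable_omega1 : Uncountable Omega1 := by
  rw [← Cardinal.aleph0_lt_mk_iff, Cardinal.mk_toType]
  simp

theorem mainTheorem5_general {κ : Type u} [Uncountable κ] :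
    (¬ IsNFree 2 (FinCo κ × FreeBA κ) ∧
      ¬ ∃ X : Set (FinCo κ × FreeBA κ), GeneratesBA X ∧ IsNIndependent 2 X) ∧
    (IsNFree 2 (FinCo κ) ∧ IsNFree 2 (FreeBA κ)) ∧
    IsNFree 3 (FinCo κ × FreeBA κ) := by
  have not_isNFree : ¬ IsNFree 2 (FinCo κ × FreeBA κ) := not_isNFree_two_finCo_prod_freeBA
  have not_isNIndependent :
      ¬ ∃ X : Set (FinCo κ × FreeBA κ), GeneratesBA X ∧ IsNIndependent 2 X :=
    fun ⟨X, generates, independent⟩ => not_isNFree ⟨X, independent.isNFreeOver generates⟩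
  exact ⟨⟨not_isNFree, not_isNIndependent⟩, ⟨FinCo.isNFree_two, FreeBA.isNFree 2⟩,
    isNFree_three_finCo_prod_freeBA⟩

theorem mainTheorem5 :
    (¬ IsNFree 2 (FinCo Omega1 × FreeBA Omega1) ∧
      ¬ ∃ X : Set (FinCo Omega1 × FreeBA Omega1), GeneratesBA X ∧ IsNIndependent 2 X) ∧
    (IsNFree 2 (FinCo Omega1) ∧ IsNFree 2 (FreeBA Omega1)) ∧
    IsNFree 3 (FinCo Omega1 × FreeBA Omega1) :=
  mainTheorem5_general
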